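/- Let $k\ge 0$ and $N\ge 1$ be integers. For $j\in\{0,\dots,N-1\}$ let $g_j:\mathbb Z/2N\to\{\pm1\}$ be the function with $g_j(x)=-1$ for $0\le x<j$, $g_j(x)=+1$ for $j\le x<N$, and $g_j(x)=-g_j(x-N)$ for $N\le x<2N$. On the Hilbert space with orthonormal basis $\{|x\rangle : x\in\mathbb Z/2N\}$ let $G_j|x\rangle=g_j(x)|x\rangle$ be the phase oracle for $g_j$ and let $T|x\rangle=|x+1\rangle$ be the translation operator. A $k$-query quantum algorithm consists of a unit vector $|\psi_0\rangle$ and unitary operators $U_1,\dots,U_k$ that do not depend on $j$; its final state for target $j$ is $|\phi_j\rangle=U_kG_jU_{k-1}\cdots U_1G_j|\psi_0\rangle$. It is called an exact, translation invariant algorithm for the $N$-element ordered search problem if $|\psi_0\rangle=\frac1{\sqrt{2N}}\sum_{x}|x\rangle$, $TU_tT^{-1}=U_t$ for all $t\in\{1,\dots,k\}$, and, for all $j\in\{0,\dots,N-1\}$, $|\phi_j\rangle=\frac1{\sqrt2}(|j\rangle+(-1)^k|j+N\rangle)$. Then there exists an exact, translation invariant, $k$-query quantum algorithm for the $N$-element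 ordered search problem if and only if the following semidefinite program $S(k,N)$ has a solution: find real symmetric positive semidefinite $N\times N$ matrices $Q_0,\dots,Q_k$ such that $$Q_0=E/N,\qquad \mathcal T_tQ_t=\mathcal T_tQ_{t-1}\ \ (1\le t\le k),\qquad Q_k=I/N,\qquad \mathrm{Tr}\,Q_t=1\ \ (0\le t\le k),$$ where $E$ is the all-ones matrix, $I$ is the identity matrix, and, for a symmetric $N\times N$ matrix $X$, $(\mathcal T_tX)_i=\mathrm{Tr}_iX+(-1)^t\,\mathrm{Tr}_{i-N}X$ for $i\in\{1,\dots,N-1\}$, with $\mathrm{Tr}_iX=\sum_{b-a=i}X_{a,b}$ the sum of the entries on the $i$-th super-diagonal (the $(-i)$-th sub-diagonal if $i<0$). -/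

import Mathlib

open scoped Matrix

noncomputable section

namespace OrderedSearch

/-- The comparison function for target `j`: `-1` at positions before `j`, `+1` from `j` on. -/
def f (j x : ℕ) : ℂ := if x < j then -1 else 1

/-- The extension of `f j` to `ℤ/2N`, for a target `j ∈ {0, …, N-1}`: equal to `f j x` for
`0 ≤ x < N` and to `-f j (x - N)` for `N ≤ x < 2N`. -/
def g (N : ℕ) (j : Fin N) (x : ZMod (2 * N)) : ℂ :=
  if x.val < N then f j x.val else -f j (x.val - N)

/-- The phase oracle `G_j |x⟩ = g_j(x) |x⟩`. -/
def oracle (N : ℕ) (j : Fin N) : Matrix (ZMod (2 * N)) (ZMod (2 * N)) ℂ :=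
  Matrix.diagonal (g N j)

/-- The translation operator `T |x⟩ = |x + 1⟩` (column `x` is the basis vector `x + 1`). -/
def translation (N : ℕ) : Matrix (ZMod (2 * N)) (ZMod (2 * N)) ℂ :=
  Matrix.of fun y x => if y = x + 1 then 1 else 0

/-- A `k`-query quantum algorithm on the state space with basis `ℤ/2N`: a unit initial state and
unitaries `U_1, …, U_k` that do not depend on the target (`U t` is `U_{t+1}`). -/
structure QueryAlgorithm (k N : ℕ) [NeZero N] where
  /-- the initial state -/
  init : ZMod (2 * N) → ℂ
  /-- the initial state is a unit vector -/
  init_norm : ∑ x, ‖init x‖ ^ 2 = 1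
  /-- the unitary operations applied after the queries -/
  U : Fin k → Matrix.unitaryGroup (ZMod (2 * N)) ℂ

/-- The state `U_t G_j ⋯ U_1 G_j |ψ₀⟩` after `t` queries when the target is `j`. -/
def QueryAlgorithm.state {k N : ℕ} [NeZero N] (A : QueryAlgorithm k N) (j : Fin N) :
    Fin (k + 1) → ZMod (2 * N) → ℂ :=
  Fin.induction A.init fun t ψ =>
    (A.U t : Matrix (ZMod (2 * N)) (ZMod (2 * N)) ℂ) *ᵥ (oracle N j *ᵥ ψ)

/-- The state `U_k G_j ⋯ U_1 G_j |ψ₀⟩` at the end of the algorithm when the target is `j`. -/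
def QueryAlgorithm.finalState {k N : ℕ} [NeZero N] (A : QueryAlgorithm k N) (j : Fin N) :
    ZMod (2 * N) → ℂ :=
  A.state j (Fin.last k)

/-- The orthonormal label states `(|j⟩ + |j + N⟩)/√2` for `k` even and `(|j⟩ - |j + N⟩)/√2` for
`k` odd. -/
def labelState (k N : ℕ) (j : Fin N) : ZMod (2 * N) → ℂ :=
  ((1 / √2 : ℝ) : ℂ) •
    (if Even k then
      Pi.single ((j : ℕ) : ZMod (2 * N)) 1 + Pi.single (((j : ℕ) + N : ℕ) : ZMod (2 * N)) 1
    else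
      Pi.single ((j : ℕ) : ZMod (2 * N)) 1 - Pi.single (((j : ℕ) + N : ℕ) : ZMod (2 * N)) 1)

/-- Exact, translation invariant algorithms: uniform initial state, unitaries with
`T U_t T⁻¹ = U_t`, and for every target `j` the final state is the label state of `j`. -/
structure QueryAlgorithm.IsExactTranslationInvariant {k N : ℕ} [NeZero N]
    (A : QueryAlgorithm k N) : Prop where
  init_eq : ∀ x, A.init x = ((1 / √(2 * N : ℝ) : ℝ) : ℂ)
  commute : ∀ t : Fin k,
    translation N * (A.U t : Matrix (ZMod (2 * N)) (ZMod (2 * N)) ℂ) * (translation N)⁻¹ =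
      (A.U t : Matrix (ZMod (2 * N)) (ZMod (2 * N)) ℂ)
  final_eq : ∀ j : Fin N, A.finalState j = labelState k N j

/-- `Tr_i X`: the sum of the entries `X a b` with `b - a = i`, i.e. the trace along the `i`th
super-diagonal (the `(-i)`th sub-diagonal for `i < 0`). -/
def diagTrace {N : ℕ} (i : ℤ) (X : Matrix (Fin N) (Fin N) ℝ) : ℝ :=
  ∑ a : Fin N, ∑ b : Fin N, if ((b : ℕ) : ℤ) - ((a : ℕ) : ℤ) = i then X a b else 0

/-- `(𝒯_t X)_i = Tr_i X + (-1)^t Tr_{i-N} X`. -/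
def signedTrace {N : ℕ} (t : ℕ) (X : Matrix (Fin N) (Fin N) ℝ) (i : ℤ) : ℝ :=
  diagTrace i X + (-1) ^ t * diagTrace (i - N) X

/-- `Q_0, …, Q_k` is a solution of the semidefinite program `S(k, N)`.  (For real matrices
`PosSemidef` includes symmetry.) -/
structure IsSDPSolution (k N : ℕ) (Q : Fin (k + 1) → Matrix (Fin N) (Fin N) ℝ) : Prop where
  posSemidef : ∀ t, (Q t).PosSemidef
  first : Q 0 = (1 / N : ℝ) • Matrix.of fun _ _ => 1
  step : ∀ (t : Fin k) (i : ℤ), 1 ≤ i → i ≤ (N : ℤ) - 1 →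
    signedTrace ((t : ℕ) + 1) (Q t.succ) i = signedTrace ((t : ℕ) + 1) (Q t.castSucc) i
  last : Q (Fin.last k) = (1 / N : ℝ) • (1 : Matrix (Fin N) (Fin N) ℝ)
  trace_eq_one : ∀ t, (Q t).trace = 1

end OrderedSearch

end

/-!
The run of a translation invariant algorithm for target `j` is the translate by `j` of the run for
target `0` (`g_eq_g_zero_sub`, `mulVec_comp_sub`), so only the states `φ_t` for target `0` matter.
The question becomes which sequences `φ_0, …, φ_k`, from the uniform state to the label state of
`0`, can be realized by `φ_t = U_t G_0 φ_{t-1}` with translation invariant unitaries `U_t`. Such a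
unitary is diagonal in the Fourier basis with phases on its diagonal, so one step is possible if and
only if `φ_t` and `G_0 φ_{t-1}` have the same power spectrum, that is, the same periodic
autocorrelation (`autocorr_mulVec`, `exists_unitary_mulVec_eq`).

Each query switches the sign by which translation by `N` acts, so that `φ_t (x + N) = (-1)^t φ_t x`
(`IsTwisted`). The state is thus determined by its first half, on which `G_0` acts trivially, and
the real part of its autocorrelation at `0 ≤ i < N` is the signed trace of the real Gram matrix
`halfGram φ_t` (`IsTwisted.re_autocorr`). Hence the Gram matrices of an algorithm satisfy the
constraints of the program. At `t = k` the Gram matrix `|0⟩⟨0|` is replaced by `I / N`, which has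
the same traces along all diagonals (`diagTrace_label`).

For the converse the positive semidefinite matrices `Q_t` have to be replaced by Gram matrices of
rank one with the same traces along all diagonals. This is the Fejér–Riesz theorem
(`exists_vec_diagTrace_eq`), which gives real vectors, so that the signed traces determine the
autocorrelations completely (`IsTwisted.autocorr_eq`). The theorem is proved by an extremal argument:
among all positive semidefinite matrices with the given diagonal traces, one that maximizes
`∑ a, a * Q a a` has rank at most one. Indeed, the Schur complement of its last diagonal entry has zero last row and
column, so that it could be moved one step down the diagonal; this would increase the objective by
the trace of the Schur complement, which therefore vanishes.
-/

noncomputable section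

namespace OrderedSearch

/-! ### Fejér–Riesz factorization by maximizing a weighted trace -/

lemma diagTrace_add {N : ℕ} (i : ℤ) (X Y : Matrix (Fin N) (Fin N) ℝ) :
    diagTrace i (X + Y) = diagTrace i X + diagTrace i Y := by
  simp only [diagTrace, ← Finset.sum_add_distrib]
  refine Finset.sum_congr rfl fun a _ => Finset.sum_congr rfl fun b _ => ?_
  split_ifs <;> simp

lemma diagTrace_zero {N : ℕ} (X : Matrix (Fin N) (Fin N) ℝ) : diagTrace 0 X = X.trace := by
  simp only [diagTrace, Matrix.trace, Matrix.diag_apply]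
  refine Finset.sum_congr rfl fun a _ => ?_
  rw [Finset.sum_eq_single a]
  · simp
  · intro b _ hb
    rw [if_neg]
    intro h
    exact hb (Fin.ext (by omega))
  · simp

lemma posSemidef_iff_real {ι : Type*} [Fintype ι] {Q : Matrix ι ι ℝ} :
    Q.PosSemidef ↔ (∀ a b, Q a b = Q b a) ∧ ∀ x : ι → ℝ, 0 ≤ x ⬝ᵥ (Q *ᵥ x) := by
  rw [Matrix.posSemidef_iff_dotProduct_mulVec]
  refine and_congr ⟨fun h a b => ?_, fun h => ?_⟩ (by simp)
  · simpa using h.apply b a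
  · ext a b
    simpa using h b a

lemma dotProduct_col {ι : Type*} [Fintype ι] {Q : Matrix ι ι ℝ} (hQ : ∀ a b, Q a b = Q b a)
    (x : ι → ℝ) (l : ι) : x ⬝ᵥ Q.col l = (Q *ᵥ x) l := by
  simp only [dotProduct, Matrix.mulVec, Matrix.col_apply]
  exact Finset.sum_congr rfl fun a _ => by rw [hQ a l, mul_comm]

lemma quadForm_add_smul_single {ι : Type*} [Fintype ι] [DecidableEq ι] {Q : Matrix ι ι ℝ}
    (hQ : ∀ a b, Q a b = Q b a) (x : ι → ℝ) (l : ι) (t : ℝ) :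
    (x + t • Pi.single l 1) ⬝ᵥ (Q *ᵥ (x + t • Pi.single l 1)) =
      x ⬝ᵥ (Q *ᵥ x) + 2 * t * (Q *ᵥ x) l + t ^ 2 * Q l l := by
  simp only [Matrix.mulVec_add, Matrix.mulVec_smul, Matrix.mulVec_single_one, dotProduct_add,
    add_dotProduct, smul_dotProduct, dotProduct_smul, single_one_dotProduct, smul_eq_mul,
    dotProduct_col hQ, Pi.add_apply, Pi.smul_apply, Matrix.col_apply]
  ring

lemma two_mul_abs_apply_le_of_posSemidef {ι : Type*} [Fintype ι] {Q : Matrix ι ι ℝ}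
    (hQ : Q.PosSemidef) (a b : ι) : 2 * |Q a b| ≤ Q a a + Q b b := by
  classical
  obtain ⟨hs, hq⟩ := posSemidef_iff_real.1 hQ
  have key (t : ℝ) (ht : t ^ 2 = 1) : 0 ≤ Q b b + 2 * t * Q a b + Q a a := by
    have := hq (Pi.single b 1 + t • Pi.single a 1)
    rw [quadForm_add_smul_single hs] at this
    simpa [ht] using this
  have h1 := key 1 (by norm_num)
  have h2 := key (-1) (by norm_num)
  rcases abs_cases (Q a b) with ⟨h, _⟩ | ⟨h, _⟩ <;> rw [h] <;> linarith

lemma apply_eq_zero_of_diag_eq_zero_of_posSemidef {ι : Type*} [Fintype ι] {Q : Matrix ι ι ℝ}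
    (hQ : Q.PosSemidef) {l : ι} (hl : Q l l = 0) (a : ι) : Q a l = 0 := by
  classical
  have h := (hQ.dotProduct_mulVec_zero_iff (Pi.single l 1)).1 (by simp [hl])
  simpa using congrFun h a

/-- The Schur complement of a diagonal entry, kept at full size. If that entry vanishes then `Q l l`
has inverse `0` and the claim is that `Q` itself is positive semidefinite. -/
lemma posSemidef_schurComplement {ι : Type*} [Fintype ι] {Q : Matrix ι ι ℝ}
    (hQ : Q.PosSemidef) (l : ι) :
    (Q - (Q l l)⁻¹ • Matrix.vecMulVec (Q.col l) (Q.col l)).PosSemidef := by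
  classical
  obtain ⟨hs, hq⟩ := posSemidef_iff_real.1 hQ
  refine posSemidef_iff_real.2 ⟨fun a b => ?_, fun x => ?_⟩
  · simp [Matrix.vecMulVec_apply, hs a b, mul_comm (Q a l)]
  · -- the shift of `x` along the basis vector at `l` that minimizes the quadratic form
    have h := hq (x + (-(Q l l)⁻¹ * (Q *ᵥ x) l) • Pi.single l 1)
    rw [quadForm_add_smul_single hs] at h
    rw [Matrix.sub_mulVec, dotProduct_sub, Matrix.smul_mulVec, Matrix.vecMulVec_mulVec]
    simp only [dotProduct_smul, smul_eq_mul, dotProduct_comm (Q.col l) x, dotProduct_col hs,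
      MulOpposite.smul_eq_mul_unop, MulOpposite.unop_op]
    rcases eq_or_ne (Q l l) 0 with h0 | h0
    · simpa [h0] using hq x
    · refine h.trans_eq ?_
      field_simp
      ring

/-- The weighted trace `∑ a, a * Q a a`, which grows when mass moves down the diagonal. -/
def weight {n : ℕ} (Q : Matrix (Fin n) (Fin n) ℝ) : ℝ := ∑ a : Fin n, (a : ℝ) * Q a a

lemma weight_add {n : ℕ} (X Y : Matrix (Fin n) (Fin n) ℝ) :
    weight (X + Y) = weight X + weight Y := by
  simp [weight, mul_add, Finset.sum_add_distrib]

/-- If the last row and column of `S` vanish, rotating the indices cyclically moves every other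
entry one step down its diagonal, and wraps only zeros around. -/
lemma diagTrace_shift {n : ℕ} {S : Matrix (Fin (n + 1)) (Fin (n + 1)) ℝ}
    (hr : ∀ a, S (Fin.last n) a = 0) (hc : ∀ a, S a (Fin.last n) = 0) (i : ℤ) :
    diagTrace i (S.submatrix (finRotate (n + 1)).symm (finRotate (n + 1)).symm) =
      diagTrace i S := by
  unfold diagTrace
  rw [← Equiv.sum_comp (finRotate (n + 1))]
  refine Finset.sum_congr rfl fun a _ => ?_
  rw [← Equiv.sum_comp (finRotate (n + 1))]
  refine Finset.sum_congr rfl fun b _ => ?_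
  rw [Matrix.submatrix_apply, Equiv.symm_apply_apply, Equiv.symm_apply_apply]
  rcases eq_or_ne a (Fin.last n) with rfl | ha
  · simp [hr]
  rcases eq_or_ne b (Fin.last n) with rfl | hb
  · simp [hc]
  rw [coe_finRotate_of_ne_last ha, coe_finRotate_of_ne_last hb]
  push_cast
  simp

lemma weight_shift {n : ℕ} {S : Matrix (Fin (n + 1)) (Fin (n + 1)) ℝ}
    (hr : ∀ a, S (Fin.last n) a = 0) :
    weight (S.submatrix (finRotate (n + 1)).symm (finRotate (n + 1)).symm) =
      weight S + S.trace := by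
  unfold weight Matrix.trace
  rw [← Equiv.sum_comp (finRotate (n + 1)), ← Finset.sum_add_distrib]
  refine Finset.sum_congr rfl fun a _ => ?_
  rw [Matrix.submatrix_apply, Equiv.symm_apply_apply]
  rcases eq_or_ne a (Fin.last n) with rfl | ha
  · simp [hr]
  rw [coe_finRotate_of_ne_last ha]
  push_cast
  simp [add_mul]

/-- Prescribing the traces along all diagonals prescribes the trace, which bounds all entries of a
positive semidefinite matrix. -/
lemma isCompact_posSemidef_diagTrace {n : ℕ} (Q₀ : Matrix (Fin n) (Fin n) ℝ) :
    IsCompact {Q : Matrix (Fin n) (Fin n) ℝ |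
      Q.PosSemidef ∧ ∀ i, diagTrace i Q = diagTrace i Q₀} := by
  have hbox : IsCompact {Q : Matrix (Fin n) (Fin n) ℝ |
      ∀ a, Q a ∈ {r : Fin n → ℝ | ∀ b, r b ∈ Set.Icc (-Q₀.trace) Q₀.trace}} :=
    isCompact_pi_infinite fun _ => isCompact_pi_infinite fun _ => isCompact_Icc
  refine hbox.of_isClosed_subset ?_ ?_
  · simp only [posSemidef_iff_real, diagTrace, Set.ofPred_and, Set.ofPred_forall]
    refine ((isClosed_iInter fun a => isClosed_iInter fun b => ?_).inter
      (isClosed_iInter fun x => ?_)).inter (isClosed_iInter fun i => ?_)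
    · exact isClosed_eq (by fun_prop) (by fun_prop)
    · exact isClosed_le continuous_const (by fun_prop)
    · refine isClosed_eq (continuous_finsetSum _ fun a _ => continuous_finsetSum _ fun b _ => ?_)
        continuous_const
      split_ifs <;> fun_prop
  · rintro Q ⟨hQ, htr⟩ a b
    have h0 (c : Fin n) : Q c c ≤ Q₀.trace := by
      rw [← diagTrace_zero, ← htr 0, diagTrace_zero]
      exact Finset.single_le_sum (f := fun c => Q c c) (fun c _ => hQ.diag_nonneg)
        (Finset.mem_univ c)
    have h := two_mul_abs_apply_le_of_posSemidef hQ a b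
    have ha := h0 a
    have hb := h0 b
    exact abs_le.1 (by linarith)

/-- Fejér–Riesz factorization: the trigonometric polynomial `∑ i, Tr_i Q * z ^ i` of a positive
semidefinite real matrix is the squared modulus of a polynomial with real coefficients `v` on the
unit circle. Equivalently, `Q` may be replaced by a rank-one matrix with the same traces along all
diagonals. -/
theorem exists_vec_diagTrace_eq {N : ℕ} {Q : Matrix (Fin N) (Fin N) ℝ} (hQ : Q.PosSemidef) :
    ∃ v : Fin N → ℝ, ∀ i, diagTrace i (Matrix.vecMulVec v v) = diagTrace i Q := by
  rcases N with _ | n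
  · exact ⟨0, fun i => by simp [diagTrace]⟩
  have hcont : Continuous (weight : Matrix (Fin (n + 1)) (Fin (n + 1)) ℝ → ℝ) := by
    unfold weight
    fun_prop
  obtain ⟨R, ⟨hR, hRQ⟩, hmax⟩ := (isCompact_posSemidef_diagTrace Q).exists_isMaxOn
    ⟨Q, hQ, fun _ => rfl⟩ hcont.continuousOn
  set l := Fin.last n
  set P := (R l l)⁻¹ • Matrix.vecMulVec (R.col l) (R.col l) with hP
  have hl : 0 ≤ R l l := hR.diag_nonneg
  have hPpsd : P.PosSemidef := by
    have := Matrix.posSemidef_vecMulVec_self_star (R.col l)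
    rw [star_trivial] at this
    exact this.smul (inv_nonneg.2 hl)
  have hS : (R - P).PosSemidef := posSemidef_schurComplement hR l
  have hc (a) : (R - P) a l = 0 := by
    rcases eq_or_ne (R l l) 0 with h0 | h0
    · simp [hP, h0, apply_eq_zero_of_diag_eq_zero_of_posSemidef hR h0 a]
    · simp [hP, Matrix.vecMulVec_apply]
      field_simp
      ring
  have hr (a) : (R - P) l a = 0 := by rw [(posSemidef_iff_real.1 hS).1, hc]
  set S' := (R - P).submatrix (finRotate (n + 1)).symm (finRotate (n + 1)).symm with hS'
  have hle : weight (P + S') ≤ weight R := by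
    refine hmax ⟨hPpsd.add (hS.submatrix _), fun i => ?_⟩
    rw [diagTrace_add, hS', diagTrace_shift hr hc, ← diagTrace_add, add_sub_cancel, hRQ]
  -- the objective gains `trace (R - P) ≥ 0`, so optimality forces the Schur complement to vanish
  have hzero : R - P = 0 := by
    refine hS.trace_eq_zero_iff.1 (le_antisymm ?_ hS.trace_nonneg)
    rw [weight_add, hS', weight_shift hr, ← add_assoc, ← weight_add, add_sub_cancel] at hle
    linarith
  refine ⟨(√(R l l))⁻¹ • R.col l, fun i => ?_⟩
  rw [← hRQ i, congrArg (diagTrace i) (sub_eq_zero.1 hzero), hP,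
    Matrix.smul_vecMulVec, Matrix.vecMulVec_smul, smul_smul,
    ← mul_inv, Real.mul_self_sqrt hl]

/-! ### Translation invariant unitaries and autocorrelation -/

/-- The periodic autocorrelation `i ↦ ∑ x, conj (ψ x) * ψ (x + i)`. -/
def autocorr {M : ℕ} [NeZero M] (ψ : ZMod M → ℂ) (i : ZMod M) : ℂ :=
  ∑ x, star (ψ x) * ψ (x + i)

/-- The cyclic shift of `ℂ^(ℤ/M)`, sending the basis vector at `x` to the one at `x + 1`. For
`M = 2 * N` it is `translation N` by definition. -/
def shift (M : ℕ) : Matrix (ZMod M) (ZMod M) ℂ := Matrix.of fun y x => if y = x + 1 then 1 else 0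

lemma shift_mulVec {M : ℕ} [NeZero M] (ψ : ZMod M → ℂ) (y : ZMod M) :
    (shift M *ᵥ ψ) y = ψ (y - 1) := by
  simp only [shift, Matrix.mulVec, dotProduct, Matrix.of_apply, ite_mul, one_mul, zero_mul]
  rw [Finset.sum_eq_single (y - 1)]
  · simp
  · intro x _ hx
    rw [if_neg]
    rintro rfl
    simp at hx
  · simp

lemma isUnit_det_shift (M : ℕ) [NeZero M] : IsUnit (shift M).det := by
  refine (Matrix.isUnit_iff_isUnit_det _).1 (Matrix.mulVec_injective_iff_isUnit.1 fun ψ φ h => ?_)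
  ext x
  simpa [shift_mulVec] using congrFun h (x + 1)

lemma conj_shift_eq_iff {M : ℕ} [NeZero M] (U : Matrix (ZMod M) (ZMod M) ℂ) :
    shift M * U * (shift M)⁻¹ = U ↔ shift M * U = U * shift M := by
  constructor
  · intro h
    conv_rhs => rw [← h]
    rw [Matrix.nonsing_inv_mul_cancel_right _ _ (isUnit_det_shift M)]
  · intro h
    rw [h, Matrix.mul_nonsing_inv_cancel_right _ _ (isUnit_det_shift M)]

lemma mulVec_comp_sub {M : ℕ} [NeZero M] {U : Matrix (ZMod M) (ZMod M) ℂ}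
    (hU : shift M * U = U * shift M) (ψ : ZMod M → ℂ) (j : ℕ) :
    U *ᵥ (fun x => ψ (x - j)) = fun x => (U *ᵥ ψ) (x - j) := by
  induction j with
  | zero => simp
  | succ j ih =>
    have h (χ : ZMod M → ℂ) : (fun x => χ (x - (j + 1 : ℕ))) = shift M *ᵥ (fun x => χ (x - j)) := by
      ext x
      rw [shift_mulVec]
      congr 1
      push_cast
      ring
    rw [h, h, ← ih, Matrix.mulVec_mulVec, ← hU, Matrix.mulVec_mulVec]

lemma autocorr_mulVec {M : ℕ} [NeZero M] {U : Matrix (ZMod M) (ZMod M) ℂ}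
    (hU : U ∈ Matrix.unitaryGroup (ZMod M) ℂ) (hT : shift M * U = U * shift M)
    (ψ : ZMod M → ℂ) : autocorr (U *ᵥ ψ) = autocorr ψ := by
  have hneg (χ : ZMod M → ℂ) (j : ℕ) :
      autocorr χ (-j) = star χ ⬝ᵥ fun x => χ (x - j) := by
    simp [autocorr, dotProduct, sub_eq_add_neg]
  ext i
  obtain ⟨j, hj⟩ := ZMod.natCast_zmod_surjective (-i)
  rw [← neg_neg i, ← hj, hneg, hneg, ← mulVec_comp_sub hT, Matrix.star_mulVec,
    ← Matrix.dotProduct_mulVec, Matrix.mulVec_mulVec, ← Matrix.star_eq_conjTranspose,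
    (Matrix.mem_unitaryGroup_iff' (A := U)).1 hU, Matrix.one_mulVec]

/-- The unitary matrix of the discrete Fourier transform on `ℤ/M`. -/
def fourierMatrix (M : ℕ) [NeZero M] : Matrix (ZMod M) (ZMod M) ℂ :=
  Matrix.of fun p x => ((√M : ℝ) : ℂ)⁻¹ * ZMod.stdAddChar (p * x)

lemma star_stdAddChar {M : ℕ} [NeZero M] (x : ZMod M) :
    star (ZMod.stdAddChar x : ℂ) = ZMod.stdAddChar (-x) := by
  rw [ZMod.stdAddChar_apply, ZMod.stdAddChar_apply, AddChar.map_neg_eq_inv, Circle.coe_inv_eq_conj]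
  rfl

lemma inv_sqrt_mul_self (M : ℕ) : ((√M : ℝ) : ℂ)⁻¹ * ((√M : ℝ) : ℂ)⁻¹ = (M : ℂ)⁻¹ := by
  rw [← mul_inv, ← Complex.ofReal_mul, Real.mul_self_sqrt (Nat.cast_nonneg _),
    Complex.ofReal_natCast]

lemma fourierMatrix_mem_unitaryGroup (M : ℕ) [NeZero M] :
    fourierMatrix M ∈ Matrix.unitaryGroup (ZMod M) ℂ := by
  rw [Matrix.mem_unitaryGroup_iff]
  ext p q
  have hM : (M : ℂ) ≠ 0 := Nat.cast_ne_zero.2 (NeZero.ne M)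
  have h (x : ZMod M) : fourierMatrix M p x * star (fourierMatrix M) x q =
      (M : ℂ)⁻¹ * ZMod.stdAddChar (x * (p - q)) := by
    simp only [Matrix.star_apply, fourierMatrix, Matrix.of_apply, star_mul', star_stdAddChar,
      star_inv₀, Complex.star_def, Complex.conj_ofReal]
    rw [mul_mul_mul_comm, inv_sqrt_mul_self, ← AddChar.map_add_eq_mul]
    congr 2
    ring
  rw [Matrix.mul_apply, Finset.sum_congr rfl fun x _ => h x, ← Finset.mul_sum,
    AddChar.sum_mulShift _ (ZMod.isPrimitive_stdAddChar M), Matrix.one_apply]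
  by_cases hpq : p = q
  · simp [hpq, hM]
  · simp [hpq, sub_eq_zero]

lemma fourierMatrix_mul_shift (M : ℕ) [NeZero M] :
    fourierMatrix M * shift M =
      Matrix.diagonal (fun p => ZMod.stdAddChar p) * fourierMatrix M := by
  ext p x
  rw [Matrix.diagonal_mul, Matrix.mul_apply, Finset.sum_eq_single (x + 1)]
  · simp only [fourierMatrix, shift, Matrix.of_apply, if_true, mul_one, mul_add,
      AddChar.map_add_eq_mul]
    ring
  · intro y _ hy
    simp [shift, hy]
  · simp

/-- The power spectrum is, up to normalization, the Fourier transform of the autocorrelation. -/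
lemma star_mul_fourierMatrix_mulVec {M : ℕ} [NeZero M] (ψ : ZMod M → ℂ) (p : ZMod M) :
    star ((fourierMatrix M *ᵥ ψ) p) * (fourierMatrix M *ᵥ ψ) p =
      (M : ℂ)⁻¹ * ∑ i, ZMod.stdAddChar (p * i) * autocorr ψ i := by
  simp only [Matrix.mulVec, dotProduct, star_sum, autocorr]
  rw [Finset.sum_mul_sum]
  simp only [Finset.mul_sum]
  conv_rhs => rw [Finset.sum_comm]
  refine Finset.sum_congr rfl fun x _ => ?_
  rw [← Equiv.sum_comp (Equiv.addLeft x)]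
  refine Finset.sum_congr rfl fun i _ => ?_
  have h : ZMod.stdAddChar (p * i) =
      (ZMod.stdAddChar (-(p * x)) * ZMod.stdAddChar (p * (x + i)) : ℂ) := by
    rw [← AddChar.map_add_eq_mul]
    congr 1
    ring
  simp only [fourierMatrix, Matrix.of_apply, star_mul', star_stdAddChar, star_inv₀,
    Complex.star_def, Complex.conj_ofReal, Equiv.coe_addLeft, h, ← inv_sqrt_mul_self]
  ring

/-- Conversely to `autocorr_mulVec`, two states with the same autocorrelation are related by a
translation invariant unitary: their Fourier coefficients differ only by phases, and an operator
that is diagonal in the Fourier basis can supply these. -/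
theorem exists_unitary_mulVec_eq {M : ℕ} [NeZero M] {ψ φ : ZMod M → ℂ}
    (h : autocorr φ = autocorr ψ) :
    ∃ U : Matrix.unitaryGroup (ZMod M) ℂ,
      shift M * (U : Matrix (ZMod M) (ZMod M) ℂ) = U * shift M ∧
        (U : Matrix (ZMod M) (ZMod M) ℂ) *ᵥ ψ = φ := by
  set F := fourierMatrix M with hF
  have hFF : F * star F = 1 := Matrix.mem_unitaryGroup_iff.1 (fourierMatrix_mem_unitaryGroup M)
  have hFF' : star F * F = 1 := Matrix.mem_unitaryGroup_iff'.1 (fourierMatrix_mem_unitaryGroup M)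
  have hmod (p) : ‖(F *ᵥ φ) p‖ = ‖(F *ᵥ ψ) p‖ := by
    have := star_mul_fourierMatrix_mulVec φ p
    rw [h, ← star_mul_fourierMatrix_mulVec ψ p] at this
    simp only [Complex.star_def, Complex.conj_mul'] at this
    exact (pow_left_inj₀ (norm_nonneg _) (norm_nonneg _) two_ne_zero).1 (by exact_mod_cast this)
  have hphase (p) : ∃ d : ℂ, d * star d = 1 ∧ d * (F *ᵥ ψ) p = (F *ᵥ φ) p := by
    rcases eq_or_ne ((F *ᵥ ψ) p) 0 with h0 | h0
    · refine ⟨1, by simp, ?_⟩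
      rw [h0, mul_zero, eq_comm, ← norm_eq_zero, hmod, h0, norm_zero]
    · refine ⟨(F *ᵥ φ) p / (F *ᵥ ψ) p, ?_, div_mul_cancel₀ _ h0⟩
      rw [Complex.star_def, Complex.mul_conj', norm_div, hmod, div_self (norm_ne_zero_iff.2 h0)]
      simp
  choose d hd hdφ using hphase
  have hD : Matrix.diagonal d ∈ Matrix.unitaryGroup (ZMod M) ℂ := by
    rw [Matrix.mem_unitaryGroup_iff, Matrix.star_eq_conjTranspose, Matrix.diagonal_conjTranspose,
      Matrix.diagonal_mul_diagonal, ← Matrix.diagonal_one]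
    congr 1
    ext p
    simpa using hd p
  have hFmem := fourierMatrix_mem_unitaryGroup M
  refine ⟨⟨star F * Matrix.diagonal d * F,
    mul_mem (mul_mem (Unitary.star_mem hFmem) hD) hFmem⟩, ?_, ?_⟩
  · have hT : shift M = star F * Matrix.diagonal (fun p => ZMod.stdAddChar p) * F := by
      rw [mul_assoc, hF, ← fourierMatrix_mul_shift, ← hF, ← mul_assoc, hFF', one_mul]
    have hconj (X Y : Matrix (ZMod M) (ZMod M) ℂ) :
        star F * X * F * (star F * Y * F) = star F * (X * Y) * F := by
      calc star F * X * F * (star F * Y * F) = star F * X * (F * star F) * Y * F := by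
            simp only [mul_assoc]
        _ = _ := by rw [hFF, mul_one]; simp only [mul_assoc]
    rw [hT, hconj, hconj, Matrix.diagonal_mul_diagonal, Matrix.diagonal_mul_diagonal]
    simp only [mul_comm]
  · have hDF : Matrix.diagonal d *ᵥ (F *ᵥ ψ) = F *ᵥ φ := by
      ext p
      rw [Matrix.mulVec_diagonal, hdφ]
    rw [← Matrix.mulVec_mulVec, ← Matrix.mulVec_mulVec, hDF, Matrix.mulVec_mulVec, hFF',
      Matrix.one_mulVec]

/-! ### Twisted states on `ℤ/2N` -/

lemma natCast_add_self (N : ℕ) : (N : ZMod (2 * N)) + N = 0 := by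
  have h : ((2 * N : ℕ) : ZMod (2 * N)) = 0 := ZMod.natCast_self _
  rw [← h]
  push_cast
  ring

lemma val_natCast_fin {N : ℕ} (a : Fin N) : ((a : ℕ) : ZMod (2 * N)).val = a :=
  ZMod.val_natCast_of_lt (by omega)

lemma val_natCast_fin_add {N : ℕ} (a : Fin N) :
    (((a : ℕ) : ZMod (2 * N)) + N).val = a + N := by
  rw [← Nat.cast_add]
  exact ZMod.val_natCast_of_lt (by omega)

lemma exists_fin_natCast {N : ℕ} [NeZero N] (x : ZMod (2 * N)) :
    ∃ a : Fin N, x = (a : ℕ) ∨ x = ((a : ℕ) : ZMod (2 * N)) + N := by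
  have hx := ZMod.val_lt x
  have hcast := ZMod.natCast_zmod_val x
  by_cases h : x.val < N
  · exact ⟨⟨x.val, h⟩, Or.inl hcast.symm⟩
  · refine ⟨⟨x.val - N, by omega⟩, Or.inr ?_⟩
    rw [← Nat.cast_add, Nat.sub_add_cancel (not_lt.1 h), hcast]

lemma sum_zmod_two_mul {N : ℕ} [NeZero N] (F : ZMod (2 * N) → ℂ) :
    ∑ x, F x = ∑ a : Fin N, (F (a : ℕ) + F ((a : ℕ) + N)) := by
  have h : ∑ x, F x = ∑ n ∈ Finset.range (N + N), F n := by
    refine Finset.sum_nbij' ZMod.val (fun n => (n : ZMod (2 * N))) ?_ ?_ ?_ ?_ ?_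
    · intro x _
      simpa [two_mul] using ZMod.val_lt x
    · simp
    · intro x _
      exact ZMod.natCast_zmod_val x
    · intro n hn
      exact ZMod.val_natCast_of_lt (by rw [two_mul]; exact Finset.mem_range.1 hn)
    · intro x _
      rw [ZMod.natCast_zmod_val]
  rw [h, Finset.sum_range_add, Finset.sum_add_distrib, Finset.sum_range, Finset.sum_range]
  simp [add_comm]

/-- Translation by `N` multiplies the state by `(-1)^t`, so that the state is determined by its
restriction to `{0, …, N - 1}`. -/
def IsTwisted (t : ℕ) {N : ℕ} (φ : ZMod (2 * N) → ℂ) : Prop :=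
  ∀ x, φ (x + N) = (-1) ^ t * φ x

/-- The real part of the Gram matrix of the first half of a state, normalized so as to have trace
one when the state is a twisted unit vector. -/
def halfGram {N : ℕ} (φ : ZMod (2 * N) → ℂ) : Matrix (Fin N) (Fin N) ℝ :=
  Matrix.of fun a b => 2 * (star (φ (a : ℕ)) * φ (b : ℕ)).re

lemma posSemidef_halfGram {N : ℕ} (φ : ZMod (2 * N) → ℂ) : (halfGram φ).PosSemidef := by
  have h (u : Fin N → ℝ) : (Matrix.vecMulVec u u).PosSemidef := by
    simpa using Matrix.posSemidef_vecMulVec_self_star u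
  have hsum := ((h fun a => (φ (a : ℕ)).re).add (h fun a => (φ (a : ℕ)).im)).smul
    (zero_le_two : (0 : ℝ) ≤ 2)
  convert hsum using 1
  ext a b
  simp [halfGram, Matrix.vecMulVec_apply]

/-- The value of a twisted state at `a + i`, read off its first half: the first sum is non-zero only
if `a + i < N`, the second only if `a + i` wraps into the second half. -/
lemma IsTwisted.apply_add {t N : ℕ} {φ : ZMod (2 * N) → ℂ} (hφ : IsTwisted t φ) (a : Fin N)
    {i : ℕ} (hi : i < N) :
    φ ((a : ℕ) + i) =
      (∑ b : Fin N, if ((b : ℕ) : ℤ) - ((a : ℕ) : ℤ) = i then φ (b : ℕ) else 0) +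
        (-1) ^ t * ∑ b : Fin N, if ((b : ℕ) : ℤ) - ((a : ℕ) : ℤ) = i - N then φ (b : ℕ) else 0 := by
  rw [← Nat.cast_add]
  by_cases h : a + i < N
  · rw [Finset.sum_eq_single ⟨a + i, h⟩, if_pos (by push_cast; ring), Finset.sum_eq_zero, mul_zero,
      add_zero]
    · intro b _
      rw [if_neg (by omega)]
    · intro b _ hb
      rw [if_neg]
      intro hab
      exact hb (Fin.ext (by simp only; omega))
    · simp
  · rw [Finset.sum_eq_zero, Finset.sum_eq_single ⟨a + i - N, by omega⟩,
      if_pos (by simp only; omega), zero_add, ← hφ, ← Nat.cast_add]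
    · congr 2
      simp only
      omega
    · intro b _ hb
      rw [if_neg]
      intro hab
      exact hb (Fin.ext (by simp only; omega))
    · simp
    · intro b _
      rw [if_neg (by omega)]

lemma IsTwisted.autocorr_add {t N : ℕ} [NeZero N] {φ : ZMod (2 * N) → ℂ} (hφ : IsTwisted t φ)
    (z : ZMod (2 * N)) : autocorr φ (z + N) = (-1) ^ t * autocorr φ z := by
  simp only [autocorr, Finset.mul_sum]
  refine Finset.sum_congr rfl fun x _ => ?_
  rw [← add_assoc, hφ]
  ring

lemma neg_one_pow_re (t : ℕ) (z : ℂ) : ((-1) ^ t * z).re = (-1) ^ t * z.re := by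
  rcases neg_one_pow_eq_or ℂ t with h | h <;> rcases Nat.even_or_odd t with ht | ht <;>
    simp [ht.neg_one_pow]

/-- The autocorrelation of a twisted state expresses exactly the quantities constrained by the
semidefinite program. -/
lemma IsTwisted.re_autocorr {t N : ℕ} [NeZero N] {φ : ZMod (2 * N) → ℂ} (hφ : IsTwisted t φ)
    {i : ℕ} (hi : i < N) : (autocorr φ i).re = signedTrace t (halfGram φ) i := by
  have hstar : star ((-1 : ℂ) ^ t) * (-1) ^ t = 1 := by
    rw [star_pow, ← mul_pow]
    simp
  have h : autocorr φ i = ∑ a : Fin N, 2 * (star (φ (a : ℕ)) * φ ((a : ℕ) + i)) := by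
    rw [autocorr, sum_zmod_two_mul]
    refine Finset.sum_congr rfl fun a _ => ?_
    rw [add_right_comm, hφ, hφ, star_mul']
    linear_combination (star (φ (a : ℕ)) * φ ((a : ℕ) + i)) * hstar
  simp only [h, Complex.re_sum, signedTrace, diagTrace, Finset.mul_sum, ← Finset.sum_add_distrib]
  refine Finset.sum_congr rfl fun a _ => ?_
  rw [hφ.apply_add a hi]
  simp only [mul_add, Finset.mul_sum, Complex.add_re, Complex.re_sum, ← Finset.sum_add_distrib]
  refine Finset.sum_congr rfl fun b _ => ?_
  congr 1
  · split_ifs <;> simp [halfGram]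
  · rw [mul_left_comm (star _), mul_left_comm (2 : ℂ), neg_one_pow_re]
    split_ifs <;> simp [halfGram]

/-- For real states the signed traces determine the whole autocorrelation. -/
lemma IsTwisted.autocorr_eq {t N : ℕ} [NeZero N] {φ ψ : ZMod (2 * N) → ℂ} (hφ : IsTwisted t φ)
    (hψ : IsTwisted t ψ) (hφr : ∀ x, star (φ x) = φ x) (hψr : ∀ x, star (ψ x) = ψ x)
    (h : ∀ i : ℕ, i < N →
      signedTrace t (halfGram φ) i = signedTrace t (halfGram ψ) i) :
    autocorr φ = autocorr ψ := by
  have him {χ : ZMod (2 * N) → ℂ} (hχ : ∀ x, star (χ x) = χ x) (z) : (autocorr χ z).im = 0 := by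
    rw [← Complex.conj_eq_iff_im, ← Complex.star_def, autocorr, star_sum]
    exact Finset.sum_congr rfl fun x _ => by rw [star_mul', star_star, hχ, hχ]
  have hcast (i : ℕ) (hi : i < N) : autocorr φ i = autocorr ψ i :=
    Complex.ext (by rw [hφ.re_autocorr hi, hψ.re_autocorr hi, h i hi]) (by rw [him hφr, him hψr])
  ext z
  obtain ⟨a, rfl | rfl⟩ := exists_fin_natCast z
  · exact hcast a a.2
  · rw [hφ.autocorr_add, hψ.autocorr_add, hcast a a.2]

lemma signedTrace_zero {t N : ℕ} (X : Matrix (Fin N) (Fin N) ℝ) :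
    signedTrace t X 0 = X.trace := by
  rw [signedTrace, diagTrace_zero]
  have h : diagTrace (0 - N) X = 0 :=
    Finset.sum_eq_zero fun a _ => Finset.sum_eq_zero fun b _ => if_neg (by omega)
  rw [h, mul_zero, add_zero]

lemma diagTrace_diagonal {N : ℕ} {i : ℤ} (hi : i ≠ 0) (d : Fin N → ℝ) :
    diagTrace i (Matrix.diagonal d) = 0 := by
  refine Finset.sum_eq_zero fun a _ => Finset.sum_eq_zero fun b _ => ?_
  split_ifs with h
  · refine Matrix.diagonal_apply_ne _ ?_
    rintro rfl
    omega
  · rfl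

lemma diagTrace_diagonal_eq {N : ℕ} {d e : Fin N → ℝ}
    (h : (Matrix.diagonal d).trace = (Matrix.diagonal e).trace) (i : ℤ) :
    diagTrace i (Matrix.diagonal d) = diagTrace i (Matrix.diagonal e) := by
  rcases eq_or_ne i 0 with rfl | hi
  · rw [diagTrace_zero, diagTrace_zero, h]
  · rw [diagTrace_diagonal hi, diagTrace_diagonal hi]

lemma g_natCast {N : ℕ} (j a : Fin N) : g N j (a : ℕ) = if a < j then -1 else 1 := by
  rw [g, val_natCast_fin, if_pos a.2, f]
  simp

lemma g_add {N : ℕ} [NeZero N] (j : Fin N) (x : ZMod (2 * N)) : g N j (x + N) = -g N j x := by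
  have h (a : Fin N) : g N j ((a : ℕ) + N) = -g N j (a : ℕ) := by
    rw [g, g, val_natCast_fin, val_natCast_fin_add, if_neg (by omega), if_pos a.2,
      Nat.add_sub_cancel]
  obtain ⟨a, rfl | rfl⟩ := exists_fin_natCast x
  · exact h a
  · rw [add_assoc, natCast_add_self, add_zero, h, neg_neg]

/-- All oracles are translates of the one for target `0`. -/
lemma g_eq_g_zero_sub {N : ℕ} [NeZero N] (j : Fin N) (x : ZMod (2 * N)) :
    g N j x = g N 0 (x - (j : ℕ)) := by
  have h (a : Fin N) : g N j (a : ℕ) = g N 0 ((a : ℕ) - (j : ℕ)) := by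
    rw [g_natCast]
    split_ifs with haj
    · have hx : ((a : ℕ) : ZMod (2 * N)) - (j : ℕ) =
          (((⟨a + N - j, by omega⟩ : Fin N) : ℕ) : ZMod (2 * N)) + N := by
        rw [Nat.cast_sub (by omega), Nat.cast_add]
        linear_combination -natCast_add_self N
      rw [hx, g_add, g_natCast, if_neg (Fin.not_lt_zero _)]
    · have hx : ((a : ℕ) : ZMod (2 * N)) - (j : ℕ) =
          (((⟨a - j, by omega⟩ : Fin N) : ℕ) : ZMod (2 * N)) := by
        rw [Nat.cast_sub (by omega)]
      rw [hx, g_natCast, if_neg (Fin.not_lt_zero _)]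
  obtain ⟨a, rfl | rfl⟩ := exists_fin_natCast x
  · exact h a
  · rw [g_add, h, add_sub_right_comm, g_add]

lemma oracle_mulVec {N : ℕ} [NeZero N] (j : Fin N) (φ : ZMod (2 * N) → ℂ) (x : ZMod (2 * N)) :
    (oracle N j *ᵥ φ) x = g N j x * φ x := by
  rw [oracle, Matrix.mulVec_diagonal]

lemma IsTwisted.oracle {t N : ℕ} [NeZero N] {φ : ZMod (2 * N) → ℂ} (hφ : IsTwisted t φ)
    (j : Fin N) : IsTwisted (t + 1) (oracle N j *ᵥ φ) := by
  intro x
  rw [oracle_mulVec, oracle_mulVec, g_add, hφ]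
  ring

/-- The query is invisible on the first half; it only switches the twist. -/
lemma halfGram_oracle {N : ℕ} [NeZero N] (φ : ZMod (2 * N) → ℂ) :
    halfGram (oracle N 0 *ᵥ φ) = halfGram φ := by
  ext a b
  simp [halfGram, oracle_mulVec, g_natCast]

lemma oracle_mulVec_sub {N : ℕ} [NeZero N] (j : Fin N) (φ : ZMod (2 * N) → ℂ) :
    oracle N j *ᵥ (fun x => φ (x - (j : ℕ))) = fun x => (oracle N 0 *ᵥ φ) (x - (j : ℕ)) := by
  ext x
  rw [oracle_mulVec, oracle_mulVec, g_eq_g_zero_sub]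

/-- The twisted state whose first half is `v / √2`. -/
def twistedExt (t : ℕ) {N : ℕ} (v : Fin N → ℝ) (x : ZMod (2 * N)) : ℂ :=
  ∑ a : Fin N, ((1 / √2 * v a : ℝ) : ℂ) *
    ((if x = (a : ℕ) then 1 else 0) + (-1) ^ t * if x = (a : ℕ) + N then 1 else 0)

lemma isTwisted_twistedExt (t : ℕ) {N : ℕ} (v : Fin N → ℝ) : IsTwisted t (twistedExt t v) := by
  intro x
  have h (a : Fin N) : x + N = (a : ℕ) ↔ x = (a : ℕ) + N := by
    constructor <;> intro h
    · linear_combination h - natCast_add_self N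
    · linear_combination h + natCast_add_self N
  have hsq : ((-1 : ℂ) ^ t) * (-1) ^ t = 1 := by
    rw [← mul_pow]
    simp
  simp only [twistedExt, h, Finset.mul_sum, add_left_inj]
  refine Finset.sum_congr rfl fun a _ => ?_
  linear_combination (-(((1 / √2 * v a : ℝ) : ℂ) * if x = (a : ℕ) + N then 1 else 0)) * hsq

lemma twistedExt_natCast (t : ℕ) {N : ℕ} (v : Fin N → ℝ) (b : Fin N) :
    twistedExt t v (b : ℕ) = ((1 / √2 * v b : ℝ) : ℂ) := by
  have h1 (a : Fin N) : ((b : ℕ) : ZMod (2 * N)) = (a : ℕ) ↔ b = a := by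
    refine ⟨fun h => ?_, fun h => by rw [h]⟩
    have := congrArg ZMod.val h
    rw [val_natCast_fin, val_natCast_fin] at this
    exact Fin.ext this
  have h2 (a : Fin N) : ((b : ℕ) : ZMod (2 * N)) ≠ (a : ℕ) + N := by
    intro h
    have := congrArg ZMod.val h
    rw [val_natCast_fin, val_natCast_fin_add] at this
    omega
  simp [twistedExt, h1, h2]

lemma star_twistedExt (t : ℕ) {N : ℕ} (v : Fin N → ℝ) (x : ZMod (2 * N)) :
    star (twistedExt t v x) = twistedExt t v x := by
  rw [twistedExt, star_sum]
  refine Finset.sum_congr rfl fun a _ => ?_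
  rw [star_mul', Complex.star_def, Complex.conj_ofReal]
  congr 1
  split_ifs <;> simp

lemma halfGram_twistedExt (t : ℕ) {N : ℕ} (v : Fin N → ℝ) :
    halfGram (twistedExt t v) = Matrix.vecMulVec v v := by
  ext a b
  have h : (√2)⁻¹ * (√2)⁻¹ = (1 / 2 : ℝ) := by
    rw [← mul_inv, Real.mul_self_sqrt zero_le_two, one_div]
  rw [halfGram, Matrix.of_apply, star_twistedExt, twistedExt_natCast, twistedExt_natCast,
    ← Complex.ofReal_mul, Complex.ofReal_re, Matrix.vecMulVec_apply, one_div]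
  linear_combination (2 * v a * v b) * h

/-- The label state of `j` is the translate by `j` of the twisted state with first half
`|0⟩ / √2`. -/
lemma twistedExt_single (k : ℕ) {N : ℕ} [NeZero N] (j : Fin N) (x : ZMod (2 * N)) :
    twistedExt k (Pi.single 0 1 : Fin N → ℝ) (x - (j : ℕ)) = labelState k N j x := by
  rw [twistedExt, Finset.sum_eq_single 0]
  · rcases Nat.even_or_odd k with hk | hk
    · simp [labelState, hk, Pi.single_apply, sub_eq_iff_eq_add, add_comm]
    · simp [labelState, Nat.not_even_iff_odd.2 hk, hk.neg_one_pow, Pi.single_apply,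
        sub_eq_iff_eq_add, add_comm]
      split_ifs <;> simp
  · intro a _ ha
    simp [ha]
  · simp

lemma twistedExt_const {N : ℕ} [NeZero N] (x : ZMod (2 * N)) :
    twistedExt 0 (fun _ : Fin N => 1 / √N) x = ((1 / √(2 * N : ℝ) : ℝ) : ℂ) := by
  obtain ⟨a, rfl | rfl⟩ := exists_fin_natCast x
  all_goals
    first
    | rw [twistedExt_natCast]
    | rw [isTwisted_twistedExt 0 _ _, pow_zero, one_mul, twistedExt_natCast]
    rw [Real.sqrt_mul zero_le_two, one_div_mul_one_div]

/-! ### Equivalence of algorithms and solutions of the program -/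

lemma QueryAlgorithm.state_succ {k N : ℕ} [NeZero N] (A : QueryAlgorithm k N) (j : Fin N)
    (t : Fin k) : A.state j t.succ =
      (A.U t : Matrix (ZMod (2 * N)) (ZMod (2 * N)) ℂ) *ᵥ (oracle N j *ᵥ A.state j t.castSucc) :=
  rfl

lemma IsTwisted.mulVec {t N : ℕ} [NeZero N] {φ : ZMod (2 * N) → ℂ} (hφ : IsTwisted t φ)
    {U : Matrix (ZMod (2 * N)) (ZMod (2 * N)) ℂ}
    (hU : shift (2 * N) * U = U * shift (2 * N)) : IsTwisted t (U *ᵥ φ) := by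
  have hN (x : ZMod (2 * N)) : x + N = x - N := by
    linear_combination natCast_add_self N
  have hφ' : (fun x => φ (x - N)) = (-1 : ℂ) ^ t • φ := by
    ext x
    rw [← hN, hφ, Pi.smul_apply, smul_eq_mul]
  intro x
  have h := congrFun (mulVec_comp_sub hU φ N) x
  rw [hφ', Matrix.mulVec_smul] at h
  rw [hN, ← h, Pi.smul_apply, smul_eq_mul]

lemma halfGram_one_div_sqrt {N : ℕ} [NeZero N] {φ : ZMod (2 * N) → ℂ}
    (h : ∀ x, φ x = ((1 / √(2 * N : ℝ) : ℝ) : ℂ)) :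
    halfGram φ = (1 / N : ℝ) • Matrix.of fun _ _ => 1 := by
  have hφ : φ = twistedExt 0 (fun _ : Fin N => 1 / √N) := by
    ext x
    rw [h, twistedExt_const]
  have hN : (N : ℝ) ≠ 0 := Nat.cast_ne_zero.2 (NeZero.ne N)
  rw [hφ, halfGram_twistedExt]
  ext a b
  rw [Matrix.vecMulVec_apply, one_div_mul_one_div, Real.mul_self_sqrt (Nat.cast_nonneg _)]
  simp

lemma halfGram_labelState_zero (k N : ℕ) [NeZero N] :
    halfGram (labelState k N 0) = Matrix.diagonal (Pi.single 0 1) := by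
  have h : labelState k N 0 = twistedExt k (Pi.single 0 1) := by
    ext x
    rw [← twistedExt_single]
    simp
  rw [h, halfGram_twistedExt]
  ext a b
  rw [Matrix.vecMulVec_apply, Matrix.diagonal_apply, Pi.single_apply, Pi.single_apply]
  split_ifs <;> simp_all

lemma inv_smul_one_eq_diagonal (N : ℕ) :
    (1 / N : ℝ) • (1 : Matrix (Fin N) (Fin N) ℝ) = Matrix.diagonal fun _ => 1 / (N : ℝ) := by
  rw [← Matrix.diagonal_one, ← Matrix.diagonal_smul]
  congr 1
  ext
  simp

lemma trace_diagonal_inv (N : ℕ) [NeZero N] :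
    (Matrix.diagonal fun _ : Fin N => 1 / (N : ℝ)).trace = 1 := by
  have hN : (N : ℝ) ≠ 0 := Nat.cast_ne_zero.2 (NeZero.ne N)
  simp [Matrix.trace_diagonal, hN]

/-- The Gram matrix of a label state and `I / N` have the same traces along all diagonals, so the
last matrix of the program may be taken to be either of them. -/
lemma diagTrace_label (N : ℕ) [NeZero N] (i : ℤ) :
    diagTrace i (Matrix.diagonal (Pi.single (0 : Fin N) (1 : ℝ))) =
      diagTrace i ((1 / N : ℝ) • (1 : Matrix (Fin N) (Fin N) ℝ)) := by
  rw [inv_smul_one_eq_diagonal]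
  refine diagTrace_diagonal_eq ?_ i
  rw [trace_diagonal_inv, Matrix.trace_diagonal]
  simp

/-- For `k = 0` the first and the last matrix of the program, or the Gram matrices of the uniform
state and of a label state, must coincide; this forces `N = 1`. -/
lemma eq_one_of_smul_one_eq_diagonal {N : ℕ} [NeZero N] {d : Fin N → ℝ}
    (h : (1 / N : ℝ) • (Matrix.of fun _ _ => 1) = Matrix.diagonal d) : N = 1 := by
  by_contra hN
  have h0 : N ≠ 0 := NeZero.ne N
  have h01 := congrFun (congrFun h ⟨0, by omega⟩) ⟨1, by omega⟩
  simp [h0] at h01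

/-- The matrices are the Gram matrices of the first halves of the states for target `0`, except that
the last one is replaced by `I / N`. -/
theorem QueryAlgorithm.IsExactTranslationInvariant.exists_isSDPSolution {k N : ℕ} [NeZero N]
    {A : QueryAlgorithm k N} (hA : A.IsExactTranslationInvariant) :
    ∃ Q : Fin (k + 1) → Matrix (Fin N) (Fin N) ℝ, IsSDPSolution k N Q := by
  set φ := A.state 0 with hφ
  have hU (t : Fin k) : shift (2 * N) * (A.U t : Matrix (ZMod (2 * N)) (ZMod (2 * N)) ℂ) =
      A.U t * shift (2 * N) := (conj_shift_eq_iff _).1 (hA.commute t)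
  have hφ0 : halfGram (φ 0) = (1 / N : ℝ) • Matrix.of fun _ _ => 1 :=
    halfGram_one_div_sqrt hA.init_eq
  have hφk : halfGram (φ (Fin.last k)) = Matrix.diagonal (Pi.single 0 1) := by
    rw [← halfGram_labelState_zero k, ← hA.final_eq 0]
    rfl
  have htw (t : Fin (k + 1)) : IsTwisted t (φ t) := by
    induction t using Fin.induction with
    | zero =>
      intro x
      change A.init _ = _ * A.init _
      simp [hA.init_eq]
    | succ t ih =>
      rw [hφ, A.state_succ]
      exact (ih.oracle 0).mulVec (hU t)
  have hstep (t : Fin k) (i : ℕ) (hi : i < N) :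
      signedTrace ((t : ℕ) + 1) (halfGram (φ t.succ)) i =
        signedTrace ((t : ℕ) + 1) (halfGram (φ t.castSucc)) i := by
    have h1 : IsTwisted ((t : ℕ) + 1) (φ t.succ) := htw t.succ
    have h2 : IsTwisted ((t : ℕ) + 1) (oracle N 0 *ᵥ φ t.castSucc) := (htw t.castSucc).oracle 0
    rw [← h1.re_autocorr hi, ← halfGram_oracle (φ t.castSucc), ← h2.re_autocorr hi, hφ,
      A.state_succ, autocorr_mulVec (A.U t).2 (hU t)]
  have htr (t : Fin (k + 1)) : (halfGram (φ t)).trace = 1 := by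
    induction t using Fin.induction with
    | zero =>
      rw [hφ0]
      simp [Matrix.trace]
    | succ t ih =>
      have h := hstep t 0 (Nat.pos_of_ne_zero (NeZero.ne N))
      rwa [Nat.cast_zero, signedTrace_zero, signedTrace_zero, ih] at h
  have hdiag (t : ℕ) (i : ℤ) : signedTrace t ((1 / N : ℝ) • (1 : Matrix (Fin N) (Fin N) ℝ)) i =
      signedTrace t (halfGram (φ (Fin.last k))) i := by
    rw [hφk, signedTrace, signedTrace, diagTrace_label, diagTrace_label]
  have hlast_tr : ((1 / N : ℝ) • (1 : Matrix (Fin N) (Fin N) ℝ)).trace = 1 := by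
    rw [inv_smul_one_eq_diagonal, trace_diagonal_inv]
  have hN : 0 ≤ (1 / N : ℝ) := by positivity
  refine ⟨fun t => if t = Fin.last k then (1 / N : ℝ) • 1 else halfGram (φ t),
    fun t => ?_, ?_, fun t i hi hiN => ?_, if_pos rfl, fun t => ?_⟩
  · split_ifs
    · exact Matrix.PosSemidef.one.smul hN
    · exact posSemidef_halfGram _
  · split_ifs with h
    · have hN1 : N = 1 :=
        eq_one_of_smul_one_eq_diagonal (hφ0.symm.trans ((congrArg (halfGram ∘ φ) h).trans hφk))
      subst hN1
      ext a b
      simp [Subsingleton.elim a b]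
    · exact hφ0
  · lift i to ℕ using by omega
    have h := hstep t i (by omega)
    have hne : t.castSucc ≠ Fin.last k := Fin.castSucc_ne_last t
    rw [if_neg hne, ← h]
    split_ifs with hlast
    · rw [hdiag, hlast]
    · rfl
  · split_ifs
    · exact hlast_tr
    · exact htr t

/-- Rank-one replacements of the matrices of a solution. The factorization is not unique, so at both
ends the vectors that belong to the prescribed initial and final states are chosen by hand. -/
lemma IsSDPSolution.exists_vec {k N : ℕ} [NeZero N]
    {Q : Fin (k + 1) → Matrix (Fin N) (Fin N) ℝ} (hQ : IsSDPSolution k N Q) :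
    ∃ v : Fin (k + 1) → Fin N → ℝ, (v 0 = fun _ => 1 / √N) ∧ v (Fin.last k) = Pi.single 0 1 ∧
      ∀ t i, diagTrace i (Matrix.vecMulVec (v t) (v t)) = diagTrace i (Q t) := by
  choose w hw using fun t => exists_vec_diagTrace_eq (hQ.posSemidef t)
  refine ⟨fun t => if t = 0 then fun _ => 1 / √N else
    if t = Fin.last k then Pi.single 0 1 else w t, if_pos rfl, ?_, fun t i => ?_⟩
  · dsimp only
    split_ifs with h h'
    · obtain rfl : k = 0 := by simpa using congrArg Fin.val h
      have hN1 : N = 1 := eq_one_of_smul_one_eq_diagonal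
        (hQ.first.symm.trans (hQ.last.trans (inv_smul_one_eq_diagonal N)))
      subst hN1
      ext a
      simp [Subsingleton.elim a 0]
    · rfl
    · exact absurd rfl h'
  · dsimp only
    split_ifs with h0 hk
    · rw [h0, hQ.first]
      congr 1
      ext a b
      rw [Matrix.vecMulVec_apply, one_div_mul_one_div, Real.mul_self_sqrt (Nat.cast_nonneg _)]
      simp
    · rw [hk, hQ.last, ← diagTrace_label]
      congr 1
      ext a b
      rw [Matrix.vecMulVec_apply, Matrix.diagonal_apply, Pi.single_apply, Pi.single_apply]
      split_ifs <;> simp_all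
    · exact hw t i

theorem IsSDPSolution.exists_queryAlgorithm {k N : ℕ} [NeZero N]
    {Q : Fin (k + 1) → Matrix (Fin N) (Fin N) ℝ} (hQ : IsSDPSolution k N Q) :
    ∃ A : QueryAlgorithm k N, A.IsExactTranslationInvariant := by
  obtain ⟨v, hv0, hvk, hv⟩ := hQ.exists_vec
  set φ : Fin (k + 1) → ZMod (2 * N) → ℂ := fun t => twistedExt t (v t) with hφ
  have hauto (t : Fin k) : autocorr (φ t.succ) = autocorr (oracle N 0 *ᵥ φ t.castSucc) := by
    have h1 : IsTwisted ((t : ℕ) + 1) (φ t.succ) := isTwisted_twistedExt _ _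
    have h2 : IsTwisted ((t : ℕ) + 1) (oracle N 0 *ᵥ φ t.castSucc) :=
      (isTwisted_twistedExt _ _).oracle 0
    have hg (x : ZMod (2 * N)) : star (g N 0 x) = g N 0 x := by
      unfold g f
      split_ifs <;> simp
    refine h1.autocorr_eq h2 (star_twistedExt _ _) (fun x => ?_) fun i hi => ?_
    · rw [oracle_mulVec, star_mul', hg, hφ, star_twistedExt]
    · rw [halfGram_oracle, hφ]
      simp only [halfGram_twistedExt]
      simp only [signedTrace, hv]
      change signedTrace _ (Q t.succ) i = signedTrace _ (Q t.castSucc) i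
      rcases Nat.eq_zero_or_pos i with rfl | hpos
      · rw [Nat.cast_zero, signedTrace_zero, signedTrace_zero, hQ.trace_eq_one, hQ.trace_eq_one]
      · exact hQ.step t i (by omega) (by omega)
  choose U hUT hU using fun t => exists_unitary_mulVec_eq (hauto t)
  have hnorm : ∑ _x : ZMod (2 * N), ‖((1 / √(2 * N : ℝ) : ℝ) : ℂ)‖ ^ 2 = 1 := by
    have hN : (N : ℝ) ≠ 0 := Nat.cast_ne_zero.2 (NeZero.ne N)
    rw [Finset.sum_const, Finset.card_univ, ZMod.card, Complex.norm_real, Real.norm_eq_abs, sq_abs,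
      div_pow, Real.sq_sqrt (by positivity)]
    simp
    field_simp
  let A : QueryAlgorithm k N := ⟨fun _ => ((1 / √(2 * N : ℝ) : ℝ) : ℂ), hnorm, U⟩
  -- by translation invariance the run for target `j` is the translate of the run for target `0`
  have hstate (j : Fin N) (t : Fin (k + 1)) : A.state j t = fun x => φ t (x - (j : ℕ)) := by
    induction t using Fin.induction with
    | zero =>
      ext x
      simp only [hφ, hv0]
      exact (twistedExt_const _).symm
    | succ t ih =>
      rw [A.state_succ, ih, oracle_mulVec_sub]
      change (U t : Matrix (ZMod (2 * N)) (ZMod (2 * N)) ℂ) *ᵥ _ = _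
      rw [mulVec_comp_sub (hUT t), hU]
  refine ⟨A, fun _ => rfl, fun t => (conj_shift_eq_iff _).2 (hUT t), fun j => ?_⟩
  ext x
  rw [QueryAlgorithm.finalState, hstate]
  simp only [hφ, hvk]
  exact twistedExt_single k j x

end OrderedSearch

end

theorem theorem3 (k N : ℕ) [NeZero N] :
    (∃ A : OrderedSearch.QueryAlgorithm k N, A.IsExactTranslationInvariant) ↔
      ∃ Q : Fin (k + 1) → Matrix (Fin N) (Fin N) ℝ, OrderedSearch.IsSDPSolution k N Q :=
  ⟨fun ⟨_, hA⟩ => hA.exists_isSDPSolution, fun ⟨_, hQ⟩ => hQ.exists_queryAlgorithm⟩
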